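/- All groups and graphs are finite, and graphs are simple. **Covers.** A graph $\mathscr G$ is a cover of the complete graph $K_n$ with fibres the preimages of points under a surjection $\pi\colon V(\mathscr G)\to[n]$ if every fibre is an independent set and the edges between any two distinct fibres form a perfect matching. If each fibre is labelled by $[r]$, the adjacency matrix becomes an $n\times n$ array of $r\times r$ blocks, which are zero on the diagonal and permutation matrices off the diagonal; the cover is *abelian* if for some such labelling the off-diagonal blocks generate an abelian group. It is *regular* if the group of automorphisms of $\mathscr G$ that map each fibre to itself acts regularly on each fibre. It is *antipodal* if $\mathscr G$ is connected and two distinct vertices are in a common fibre exactly when their distance is the diameter. An *$(n,r,c)$-drackn* is a distance-regular antipodal cover of $K_n$ with fibres of size $r$ in which any two vertices at distance $2$ have exactly $c$ common neighbours; it is *abelian* if it is abelian as a cover. **Roux.** Let $\Gamma$ be an abelian group and $B\in\mathbb C[\Gamma]^{n\times n}$. Consider - (R1) $B_{ii}=0$ for every $i$; - (R2) $B_{ij}\in\Gamma$ for all $i\ne j$; - (R3) $B_{ji}=(B_{ij})^{-1}$ for all $i\ne j$; - (R4) the linear span of $\{gI\}_{g\in\Gamma}\cup\{gB\}_{g\in\Gamma}$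 is an algebra. $B$ is a *roux* for $\Gamma$ if (R1)–(R4) hold, and its *parameters* are the numbers $\{c_g\}_{g\in\Gamma}$ with $B^2=(n-1)I+\sum_{g\in\Gamma}c_g\,gB$. Let $\lceil B\rfloor\in\mathbb C^{([n]\times\Gamma)\times([n]\times\Gamma)}$ be obtained by applying the Cayley (left regular) representation of $\Gamma$ to every entry of $B$. The graph with adjacency matrix $\lceil B\rfloor$ (for a roux $B$), up to relabelling the vertices, is a *roux graph*; its fibres are the sets $\{i\}\times\Gamma$. **Theorem.** In (a), (c), (d) assume $n\ge2$, and in (c), (d) assume that $\Gamma$ is nontrivial. (a) Every abelian $(n,r,c)$-drackn is, with its fibres, a roux graph for an abelian group $\Gamma$ of order $r$, with parameters $$c_g=\begin{cases}n-c(r-1)-2&\text{if }g=\mathrm{id};\\ c&\text{otherwise,}\end{cases}\qquad c>0.\qquad(\ast)$$ Here $\Gamma$ can be taken to be any abelian group generated by the off-diagonal blocks in a labelling of the fibres. (b) Given a finite abelian group $\Gamma$, a matrix $B\in\mathbb C[\Gamma]^{n\times n}$ satisfies (R1)–(R3) if and only if $\lceil B\rfloor$ is the adjacency matrix of an abelian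 cover of $K_n$ with fibres $\{i\}\times\Gamma$, $i\in[n]$. (c) A roux graph for $\Gamma$ has diameter $3$ if and only if its parameters satisfy $c_g>0$ for every non-identity $g\in\Gamma$, in which case the graph is (with respect to its fibres) an antipodal regular cover of $K_n$. (d) Every roux graph for $\Gamma$ with parameters $(\ast)$, where $r=|\Gamma|$ and $c$ is a positive integer, is an abelian $(n,r,c)$-drackn. -/

import Mathlib

open scoped ComplexOrder

namespace Roux

/-! ### Covers, antipodal graphs, distance-regular graphs -/

section Graphs

variable {V W : Type*}

/-- `G` is a cover of `H` with covering map `π`: the map `π` is surjective, no edge of `G` joins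
two fibres over non-adjacent vertices of `H` (in particular each fibre is independent), and the
edges between the fibres over two adjacent vertices of `H` form a perfect matching. -/
structure IsCover (G : SimpleGraph V) (H : SimpleGraph W) (π : V → W) : Prop where
  surj : Function.Surjective π
  adj : ∀ x y, G.Adj x y → H.Adj (π x) (π y)
  matching : ∀ x w, H.Adj (π x) w → ∃! y, π y = w ∧ G.Adj x y

/-- `G` is antipodal with respect to the fibres of `π`: it is connected, and two distinct vertices
lie in a common fibre exactly when their distance is the diameter. -/
structure IsAntipodal (G : SimpleGraph V) (π : V → W) : Prop where
  connected : G.Connected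
  dist_eq_diam_iff : ∀ u v, u ≠ v → (G.dist u v = G.diam ↔ π u = π v)

/-- Distance-regular graphs (connected): the number of vertices at distance `i` from `u` and at
distance `j` from `v` is determined by `i`, `j` and the distance between `u` and `v`. -/
structure IsDistanceRegular (G : SimpleGraph V) : Prop where
  connected : G.Connected
  count : ∀ (i j : ℕ) (u v u' v' : V), G.dist u v = G.dist u' v' →
    {w | G.dist u w = i ∧ G.dist v w = j}.ncard = {w | G.dist u' w = i ∧ G.dist v' w = j}.ncard

/-- `G` is an `(n, r, c)`-drackn with fibre map `π`: a distance-regular antipodal cover of the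
complete graph on `n` vertices, with fibres of size `r`, in which every two vertices at distance
two have `c` common neighbours. -/
structure IsDrackn {n : ℕ} (G : SimpleGraph V) (π : V → Fin n) (r c : ℕ) : Prop where
  cover : IsCover G (⊤ : SimpleGraph (Fin n)) π
  antipodal : IsAntipodal G π
  distanceRegular : IsDistanceRegular G
  card_fibre : ∀ i, {v | π v = i}.ncard = r
  card_common : ∀ u v, G.dist u v = 2 → (G.commonNeighbors u v).ncard = c

/-- The labelling `e` identifies every fibre of `π` with `Fin r`; with respect to it, the adjacency
matrix of `G` is an `n × n` array of `r × r` blocks whose diagonal blocks are zero and whose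
`(i, j)` block, for `i ≠ j`, is the permutation matrix of `σ i j`. -/
structure IsBlockForm {n r : ℕ} (G : SimpleGraph V) (π : V → Fin n)
    (e : V ≃ Fin n × Fin r) (σ : Fin n → Fin n → Equiv.Perm (Fin r)) : Prop where
  fibre : ∀ v, (e v).1 = π v
  diag : ∀ i a b, ¬ G.Adj (e.symm (i, a)) (e.symm (i, b))
  offDiag : ∀ i j, i ≠ j → ∀ a b,
    (G.Adj (e.symm (i, a)) (e.symm (j, b)) ↔ σ i j b = a)

/-- The group generated by the off-diagonal blocks. -/
def blockGroup {n r : ℕ} (σ : Fin n → Fin n → Equiv.Perm (Fin r)) :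
    Subgroup (Equiv.Perm (Fin r)) :=
  Subgroup.closure {τ | ∃ i j, i ≠ j ∧ τ = σ i j}

/-- `G` is an abelian cover of the complete graph on `n` vertices with fibre map `π`: for some
labelling of the fibres, the off-diagonal blocks of the adjacency matrix generate an abelian
group. -/
def IsAbelianCover {n : ℕ} (G : SimpleGraph V) (π : V → Fin n) : Prop :=
  IsCover G (⊤ : SimpleGraph (Fin n)) π ∧
    ∃ (r : ℕ) (e : V ≃ Fin n × Fin r) (σ : Fin n → Fin n → Equiv.Perm (Fin r)),
      IsBlockForm G π e σ ∧ ∀ s ∈ blockGroup σ, ∀ t ∈ blockGroup σ, s * t = t * s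

/-- Abelian `(n, r, c)`-drackns. -/
def IsAbelianDrackn {n : ℕ} (G : SimpleGraph V) (π : V → Fin n) (r c : ℕ) : Prop :=
  IsDrackn G π r c ∧ IsAbelianCover G π

/-- `G` is a regular cover of the complete graph on `n` vertices with fibre map `π`: the group of
automorphisms of `G` that map every fibre to itself acts regularly on each fibre. -/
def IsRegularCover {n : ℕ} (G : SimpleGraph V) (π : V → Fin n) : Prop :=
  IsCover G (⊤ : SimpleGraph (Fin n)) π ∧
    ∀ u v, π u = π v → ∃! φ : G ≃g G, (∀ x, π (φ x) = π x) ∧ φ u = v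

end Graphs

/-! ### Roux -/

section Roux

variable {n : ℕ} {Γ : Type*} [CommGroup Γ]

/-- The first three roux axioms, for a matrix `B` over the group algebra `ℂ[Γ]`. -/
structure SatisfiesR123 (B : Matrix (Fin n) (Fin n) (MonoidAlgebra ℂ Γ)) : Prop where
  /-- the diagonal is zero -/
  r1 : ∀ i, B i i = 0
  /-- the off-diagonal entries are group elements -/
  r2 : ∀ i j, i ≠ j → ∃ g : Γ, B i j = MonoidAlgebra.of ℂ Γ g
  /-- `B j i` is the inverse of `B i j` -/
  r3 : ∀ i j, i ≠ j → B i j * B j i = 1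

/-- A roux for `Γ`: the first three axioms hold, and the linear span of all matrices `g I` and
`g B` with `g ∈ Γ` is an algebra. -/
structure IsRoux (B : Matrix (Fin n) (Fin n) (MonoidAlgebra ℂ Γ)) : Prop
    extends SatisfiesR123 B where
  r4 : ∃ A : Subalgebra ℂ (Matrix (Fin n) (Fin n) (MonoidAlgebra ℂ Γ)),
    Subalgebra.toSubmodule A = Submodule.span ℂ
      (Set.range (fun g : Γ => MonoidAlgebra.of ℂ Γ g •
          (1 : Matrix (Fin n) (Fin n) (MonoidAlgebra ℂ Γ))) ∪
        Set.range (fun g : Γ => MonoidAlgebra.of ℂ Γ g • B))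

/-- The numbers `c g` are roux parameters of `B`: `B² = (n - 1) I + ∑ g, c g • g B`. -/
def IsRouxParams [Fintype Γ] (B : Matrix (Fin n) (Fin n) (MonoidAlgebra ℂ Γ)) (c : Γ → ℂ) : Prop :=
  B * B = ((n : ℂ) - 1) • (1 : Matrix (Fin n) (Fin n) (MonoidAlgebra ℂ Γ)) +
    ∑ g : Γ, c g • (MonoidAlgebra.of ℂ Γ g • B)

/-- The matrix `⌈B⌋`: the Cayley (left regular) representation applied to every entry of `B`. The
Cayley matrix of `x ∈ ℂ[Γ]` has as its `(g, h)` entry the coefficient of `g` in `x * h`, that is,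
the coefficient of `g * h⁻¹` in `x`. -/
def cayley (B : Matrix (Fin n) (Fin n) (MonoidAlgebra ℂ Γ)) :
    Matrix (Fin n × Γ) (Fin n × Γ) ℂ :=
  Matrix.of fun u v => (B u.1 v.1).coeff (u.2 * v.2⁻¹)

open Classical in
/-- `G` is, up to a labelling of its vertices that maps the fibre `π v` of each vertex `v` to the
block containing it, the graph with adjacency matrix `⌈B⌋` for some roux `B` for `Γ` with
parameters `c`. -/
def IsRouxGraph {V : Type*} [Fintype Γ] (G : SimpleGraph V) (π : V → Fin n) (c : Γ → ℂ) : Prop :=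
  ∃ B : Matrix (Fin n) (Fin n) (MonoidAlgebra ℂ Γ), IsRoux B ∧ IsRouxParams B c ∧
    ∃ e : V ≃ Fin n × Γ, (∀ v, (e v).1 = π v) ∧ G.adjMatrix ℂ = (cayley B).submatrix e e

open Classical in
/-- `⌈B⌋` is the adjacency matrix of an abelian cover of the complete graph, with the fibres given
by the block structure. -/
def CayleyIsAbelianCover (B : Matrix (Fin n) (Fin n) (MonoidAlgebra ℂ Γ)) : Prop :=
  ∃ G : SimpleGraph (Fin n × Γ), G.adjMatrix ℂ = cayley B ∧ IsAbelianCover G Prod.fst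

open Classical in
/-- The parameters `n - c (r - 1) - 2` at the identity and `c` elsewhere. -/
noncomputable def drackParams (Γ : Type*) [CommGroup Γ] (n r c : ℕ) : Γ → ℂ := fun g =>
  if g = 1 then (n : ℂ) - (c : ℂ) * ((r : ℂ) - 1) - 2 else (c : ℂ)

end Roux

end Roux

open Roux

/-! A matrix with (R1)–(R3) is a gain function: group elements `b i j` for `i ≠ j` with `b j i`
inverse to `b i j`. Its graph joins `(i, x)` to `(j, y)` exactly when `i ≠ j` and `x = b i j * y`.
Coefficients of `B²` count two-step paths by gain, and these paths are the common neighbours of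
vertices with a given label quotient. So the parameter `c g` is the number of common neighbours of
two vertices in distinct fibres whose labels deviate from adjacency by `g`, with `g = 1` meaning
adjacent (`isRouxParams_gainMatrix`, `IsGainGraph.ncard_commonNeighbors_eq`).

For (c), positivity off the identity says that non-adjacent vertices in distinct fibres have a
midpoint. Mates in a fibre are never at distance 2, so they are the pairs at distance 3. Right
translations of the labels commute with the gains and give the regular action.

For (d), the distance matrices lie in the span of `I`, `A`, the same-fibre matrix and the all-ones
matrix, whose products depend only on distance (`IsCover.isDistanceRegular`).

For (a), connectedness makes the abelian block group transitive, hence regular, so its elements can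
serve as labels (`IsBlockForm.exists_isGainGraph`). Antipodality puts non-adjacent vertices of
distinct fibres at distance 2, which gives the parameters off the identity; counting all two-step
paths gives the remaining one. -/

namespace Roux

/-! ### Gain functions and the parameter equation -/

section Gain

variable {n : ℕ} {Γ : Type*} [CommGroup Γ]

/-- The matrix over `ℂ[Γ]` with zero diagonal and off-diagonal entries `b i j`. -/
noncomputable def gainMatrix (b : Fin n → Fin n → Γ) :
    Matrix (Fin n) (Fin n) (MonoidAlgebra ℂ Γ) :=
  Matrix.of fun i j => if i = j then 0 else MonoidAlgebra.of ℂ Γ (b i j)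

/-- The number of paths of length two from `i` to `j` with gain `h`. -/
noncomputable def pathCount (b : Fin n → Fin n → Γ) (i j : Fin n) (h : Γ) : ℕ :=
  {k | k ≠ i ∧ k ≠ j ∧ b i k * b k j = h}.ncard

theorem satisfiesR123_gainMatrix {b : Fin n → Fin n → Γ}
    (hb : ∀ i j, i ≠ j → b i j * b j i = 1) : SatisfiesR123 (gainMatrix b) where
  r1 i := by simp [gainMatrix]
  r2 i j h := ⟨b i j, by simp [gainMatrix, h]⟩
  r3 i j h := by
    simp only [gainMatrix, Matrix.of_apply, h, h.symm, if_false]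
    rw [← map_mul, hb i j h, map_one]

theorem SatisfiesR123.exists_eq_gainMatrix {B : Matrix (Fin n) (Fin n) (MonoidAlgebra ℂ Γ)}
    (hB : SatisfiesR123 B) :
    ∃ b : Fin n → Fin n → Γ, (∀ i j, i ≠ j → b i j * b j i = 1) ∧ B = gainMatrix b := by
  choose! b hb using hB.r2
  refine ⟨b, fun i j h => ?_, ?_⟩
  · have := hB.r3 i j h
    rw [hb i j h, hb j i h.symm, ← map_mul, ← map_one (MonoidAlgebra.of ℂ Γ)] at this
    exact MonoidAlgebra.of_injective this
  · ext1 i j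
    by_cases h : i = j
    · subst h; simp [gainMatrix, hB.r1]
    · simp [gainMatrix, h, hb i j h]

open Classical in
theorem coeff_gainMatrix (b : Fin n → Fin n → Γ) (i j : Fin n) (h : Γ) :
    (gainMatrix b i j).coeff h = if i ≠ j ∧ b i j = h then 1 else 0 := by
  by_cases hij : i = j
  · simp [gainMatrix, hij]
  · simp [gainMatrix, hij, Finsupp.single_apply]

theorem coeff_gainMatrix_mul_self (b : Fin n → Fin n → Γ) (i j : Fin n) (h : Γ) :
    ((gainMatrix b * gainMatrix b) i j).coeff h = (pathCount b i j h : ℂ) := by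
  classical
  have hk : ∀ k, (gainMatrix b i k * gainMatrix b k j).coeff h =
      if k ≠ i ∧ k ≠ j ∧ b i k * b k j = h then 1 else 0 := by
    intro k
    by_cases hki : k = i
    · simp [gainMatrix, hki]
    by_cases hkj : k = j
    · simp [gainMatrix, hkj]
    simp [gainMatrix, hki, hkj, Ne.symm hki, MonoidAlgebra.single_mul_single,
      Finsupp.single_apply]
  rw [Matrix.mul_apply, MonoidAlgebra.coeff_sum, Finsupp.finsetSum_apply, pathCount,
    Finset.sum_congr rfl fun k _ => hk k, Finset.sum_boole, Set.ncard_eq_toFinset_card']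
  congr 2
  ext k
  simp

theorem pathCount_self {b : Fin n → Fin n → Γ} (hb : ∀ i j, i ≠ j → b i j * b j i = 1)
    (i : Fin n) (h : Γ) [Decidable (h = 1)] :
    (pathCount b i i h : ℂ) = if h = 1 then (n : ℂ) - 1 else 0 := by
  split_ifs with h1
  · have : {k | k ≠ i ∧ k ≠ i ∧ b i k * b k i = h} = {i}ᶜ := by
      ext k
      simp only [Set.mem_ofPred_eq, Set.mem_compl_iff, Set.mem_singleton_iff]
      exact ⟨fun H => H.1, fun H => ⟨H, H, by rw [hb i k (Ne.symm H), h1]⟩⟩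
    have hn : 1 ≤ n := Fin.pos i
    rw [pathCount, this, Set.ncard_compl, Set.ncard_singleton, Nat.card_eq_fintype_card,
      Fintype.card_fin]
    push_cast [hn]
    rfl
  · have : {k | k ≠ i ∧ k ≠ i ∧ b i k * b k i = h} = ∅ := by
      ext k
      simp only [Set.mem_ofPred_eq, Set.mem_empty_iff_false, iff_false]
      exact fun H => h1 (by rw [← H.2.2, hb i k (Ne.symm H.1)])
    rw [pathCount, this, Set.ncard_empty, Nat.cast_zero]

/-- Compare coefficients entrywise. The diagonal imposes no condition, because a path `i, k, i`
always has gain `1`. -/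
theorem isRouxParams_gainMatrix [Fintype Γ] {b : Fin n → Fin n → Γ}
    (hb : ∀ i j, i ≠ j → b i j * b j i = 1) (c : Γ → ℂ) :
    IsRouxParams (gainMatrix b) c ↔
      ∀ i j, i ≠ j → ∀ g, (pathCount b i j (g * b i j) : ℂ) = c g := by
  classical
  have hR : ∀ i j h, ((((n : ℂ) - 1) • (1 : Matrix (Fin n) (Fin n) (MonoidAlgebra ℂ Γ)) +
      ∑ g : Γ, c g • (MonoidAlgebra.of ℂ Γ g • gainMatrix b)) i j).coeff h
      = if i = j then (if h = 1 then (n : ℂ) - 1 else 0) else c (h * (b i j)⁻¹) := by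
    intro i j h
    by_cases hij : i = j
    · subst hij
      by_cases h1 : h = 1 <;>
        simp [Matrix.sum_apply, gainMatrix, MonoidAlgebra.one_def, h1]
    · simp [Matrix.sum_apply, MonoidAlgebra.coeff_sum, hij, gainMatrix,
        MonoidAlgebra.single_mul_single, Finsupp.single_apply, ← eq_mul_inv_iff_mul_eq]
  rw [IsRouxParams, ← Matrix.ext_iff]
  constructor
  · intro H i j hij g
    have := congrArg (fun x => x.coeff (g * b i j)) (H i j)
    simp only [coeff_gainMatrix_mul_self, hR, hij, if_false, mul_inv_cancel_right] at this
    exact this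
  · intro H i j
    ext h
    rw [coeff_gainMatrix_mul_self, hR]
    split_ifs with hij h1
    · subst hij; simp [pathCount_self hb, h1]
    · subst hij; simp [pathCount_self hb, h1]
    · simpa using H i j hij (h * (b i j)⁻¹)

/-- The quadratic relation puts `B²` in the span, which is therefore closed under multiplication; so
(R4) never has to be verified separately. -/
theorem isRoux_of_isRouxParams [Fintype Γ] {B : Matrix (Fin n) (Fin n) (MonoidAlgebra ℂ Γ)}
    (hB : SatisfiesR123 B) {c : Γ → ℂ} (hc : IsRouxParams B c) : IsRoux B := by
  refine ⟨hB, ?_⟩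
  set s : Set (Matrix (Fin n) (Fin n) (MonoidAlgebra ℂ Γ)) :=
    (Set.range (fun g : Γ => MonoidAlgebra.of ℂ Γ g •
          (1 : Matrix (Fin n) (Fin n) (MonoidAlgebra ℂ Γ))) ∪
        Set.range (fun g : Γ => MonoidAlgebra.of ℂ Γ g • B)) with hs
  have hI : ∀ g : Γ, MonoidAlgebra.of ℂ Γ g •
      (1 : Matrix (Fin n) (Fin n) (MonoidAlgebra ℂ Γ)) ∈ Submodule.span ℂ s :=
    fun g => Submodule.subset_span (Or.inl ⟨g, rfl⟩)
  have hBm : ∀ g : Γ, MonoidAlgebra.of ℂ Γ g • B ∈ Submodule.span ℂ s :=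
    fun g => Submodule.subset_span (Or.inr ⟨g, rfl⟩)
  have hmul : Submodule.span ℂ s * Submodule.span ℂ s ≤ Submodule.span ℂ s := by
    rw [Submodule.span_mul_span, Submodule.span_le]
    rintro _ ⟨_, (⟨g, rfl⟩ | ⟨g, rfl⟩), _, (⟨h, rfl⟩ | ⟨h, rfl⟩), rfl⟩
    · simpa [smul_smul, ← map_mul] using hI (h * g)
    · simpa [smul_smul, ← map_mul] using hBm (h * g)
    · simpa [smul_smul, ← map_mul] using hBm (h * g)
    · have : MonoidAlgebra.of ℂ Γ g • B * MonoidAlgebra.of ℂ Γ h • B =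
        ((n : ℂ) - 1) • (MonoidAlgebra.of ℂ Γ (g * h) •
            (1 : Matrix (Fin n) (Fin n) (MonoidAlgebra ℂ Γ))) +
          ∑ k : Γ, c k • (MonoidAlgebra.of ℂ Γ (g * h * k) • B) := by
        rw [Matrix.smul_mul, Matrix.mul_smul, smul_smul, ← map_mul, hc, smul_add,
          smul_comm, Finset.smul_sum]
        congr 1
        refine Finset.sum_congr rfl fun k _ => ?_
        rw [smul_comm, smul_smul, ← map_mul]
      simp only [SetLike.mem_coe, this]
      exact Submodule.add_mem _ (Submodule.smul_mem _ _ (hI _))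
        (Submodule.sum_mem _ fun k _ => Submodule.smul_mem _ _ (hBm _))
  refine ⟨(Submodule.span ℂ s).toSubalgebra (by
    have := hI 1
    rwa [map_one, one_smul] at this) fun x y hx hy =>
    hmul (Submodule.mul_mem_mul hx hy), ?_⟩
  simp

/-- With respect to the labelling `e`, two vertices are adjacent if and only if they lie in
different fibres and their labels differ by the gain. -/
structure IsGainGraph {V : Type*} (G : SimpleGraph V) (e : V ≃ Fin n × Γ)
    (b : Fin n → Fin n → Γ) : Prop where
  inv : ∀ i j, i ≠ j → b i j * b j i = 1
  adj : ∀ u v, G.Adj u v ↔ (e u).1 ≠ (e v).1 ∧ (e u).2 = b (e u).1 (e v).1 * (e v).2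

open Classical in
theorem adjMatrix_eq_cayley_iff {V : Type*} (G : SimpleGraph V) (e : V ≃ Fin n × Γ)
    (b : Fin n → Fin n → Γ) :
    G.adjMatrix ℂ = (cayley (gainMatrix b)).submatrix e e ↔
      ∀ u v, G.Adj u v ↔ (e u).1 ≠ (e v).1 ∧ (e u).2 = b (e u).1 (e v).1 * (e v).2 := by
  rw [← Matrix.ext_iff]
  refine forall₂_congr fun u v => ?_
  simp only [SimpleGraph.adjMatrix_apply, Matrix.submatrix_apply, cayley, Matrix.of_apply,
    coeff_gainMatrix]
  have : b (e u).1 (e v).1 = (e u).2 * (e v).2⁻¹ ↔ (e u).2 = b (e u).1 (e v).1 * (e v).2 := by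
    rw [eq_mul_inv_iff_mul_eq, eq_comm]
  rw [this]
  split_ifs <;> simp_all

theorem isRouxGraph_iff {V : Type*} [Fintype Γ] (G : SimpleGraph V) (π : V → Fin n)
    (c : Γ → ℂ) :
    IsRouxGraph G π c ↔ ∃ (e : V ≃ Fin n × Γ) (b : Fin n → Fin n → Γ),
      (∀ v, (e v).1 = π v) ∧ IsGainGraph G e b ∧
        ∀ i j, i ≠ j → ∀ g, (pathCount b i j (g * b i j) : ℂ) = c g := by
  constructor
  · rintro ⟨B, hB, hc, e, he, hG⟩
    obtain ⟨b, hb, rfl⟩ := hB.toSatisfiesR123.exists_eq_gainMatrix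
    exact ⟨e, b, he, ⟨hb, (adjMatrix_eq_cayley_iff G e b).1 hG⟩,
      (isRouxParams_gainMatrix hb c).1 hc⟩
  · rintro ⟨e, b, he, hG, hc⟩
    have hp := (isRouxParams_gainMatrix hG.inv c).2 hc
    exact ⟨gainMatrix b, isRoux_of_isRouxParams (satisfiesR123_gainMatrix hG.inv) hp, hp, e, he,
      (adjMatrix_eq_cayley_iff G e b).2 hG.adj⟩

end Gain
-- Covers of complete graphs: rigidity and diameter
section Cover

variable {V W : Type*} {G : SimpleGraph V} {π : V → W}

theorem IsCover.map_ne (h : IsCover G ⊤ π) {u v : V} (huv : G.Adj u v) : π u ≠ π v :=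
  (SimpleGraph.top_adj _ _).1 (h.adj u v huv)

theorem IsCover.exists_adj (h : IsCover G ⊤ π) {u : V} {w : W} (hw : π u ≠ w) :
    ∃ v, π v = w ∧ G.Adj u v :=
  (h.matching u w ((SimpleGraph.top_adj _ _).2 hw)).exists

theorem IsCover.eq_of_adj (h : IsCover G ⊤ π) {u v w : V} (hv : G.Adj u v) (hw : G.Adj u w)
    (hvw : π v = π w) : v = w :=
  (h.matching u (π w) (h.adj u w hw)).unique ⟨hvw, hv⟩ ⟨rfl, hw⟩

/-- A midpoint would have two neighbours in one fibre, against the perfect matching. -/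
theorem IsCover.dist_ne_two (h : IsCover G ⊤ π) {u v : V} (huv : π u = π v) :
    G.dist u v ≠ 2 := by
  intro h2
  obtain ⟨p, hp⟩ := SimpleGraph.exists_walk_of_dist_ne_zero (G := G) (u := u) (v := v) (by omega)
  rw [h2] at hp
  match p, hp with
  | .cons h1 (.cons h3 .nil), _ =>
    have := h.eq_of_adj h1.symm h3 huv
    subst this
    simp at h2

/-- Agreement spreads along edges: the image of a neighbour is determined by its fibre and by the
image of the vertex already treated. -/
theorem IsCover.iso_eq (h : IsCover G ⊤ π) (hc : G.Connected) {φ ψ : G ≃g G}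
    (hφ : ∀ x, π (φ x) = π x) (hψ : ∀ x, π (ψ x) = π x) {u : V} (hu : φ u = ψ u) : φ = ψ := by
  ext v
  obtain ⟨p⟩ := hc.preconnected u v
  induction p with
  | nil => exact hu
  | cons hadj _ ih =>
    refine ih (h.eq_of_adj (φ.map_adj_iff.2 hadj) ?_ ((hφ _).trans (hψ _).symm))
    rw [hu]
    exact ψ.map_adj_iff.2 hadj

/-- Non-adjacent vertices in different fibres have a common neighbour. -/
def HasMidpoints (G : SimpleGraph V) (π : V → W) : Prop :=
  ∀ u v, π u ≠ π v → ¬ G.Adj u v → ∃ w, G.Adj u w ∧ G.Adj w v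

theorem HasMidpoints.exists_walk_le_two (hm : HasMidpoints G π) {u v : V} (huv : π u ≠ π v) :
    ∃ p : G.Walk u v, p.length ≤ 2 := by
  by_cases h : G.Adj u v
  · exact ⟨h.toWalk, by simp⟩
  · obtain ⟨w, h1, h2⟩ := hm u v huv h
    exact ⟨.cons h1 h2.toWalk, by simp⟩

theorem IsCover.exists_walk_le_three [Nontrivial W] (h : IsCover G ⊤ π) (hm : HasMidpoints G π)
    (u v : V) : ∃ p : G.Walk u v, p.length ≤ 3 := by
  by_cases huv : π u = π v
  -- From a mate, step out to another fibre; midpoints then provide at most two further edges.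
  · obtain ⟨w, hw⟩ := exists_ne (π u)
    obtain ⟨x, rfl, hx⟩ := h.exists_adj hw.symm
    obtain ⟨p, hp⟩ := hm.exists_walk_le_two (huv ▸ hw : π x ≠ π v)
    exact ⟨.cons hx p, by rw [SimpleGraph.Walk.length_cons]; omega⟩
  · obtain ⟨p, hp⟩ := hm.exists_walk_le_two huv
    exact ⟨p, by omega⟩

theorem IsCover.connected [Nontrivial W] (h : IsCover G ⊤ π) (hm : HasMidpoints G π) :
    G.Connected :=
  have : Nonempty V := ⟨(h.surj (Classical.arbitrary W)).choose⟩
  ⟨fun u v => ⟨(h.exists_walk_le_three hm u v).choose⟩⟩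

theorem IsCover.dist_le_three [Nontrivial W] (h : IsCover G ⊤ π) (hm : HasMidpoints G π)
    (u v : V) : G.dist u v ≤ 3 := by
  obtain ⟨p, hp⟩ := h.exists_walk_le_three hm u v
  exact (SimpleGraph.dist_le p).trans hp

theorem IsCover.dist_eq_three_iff [Nontrivial W] (h : IsCover G ⊤ π) (hm : HasMidpoints G π)
    {u v : V} (huv : u ≠ v) : G.dist u v = 3 ↔ π u = π v := by
  constructor
  · intro h3
    by_contra hne
    obtain ⟨p, hp⟩ := hm.exists_walk_le_two hne
    have := SimpleGraph.dist_le p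
    omega
  · intro hπ
    have h0 := (h.connected hm).pos_dist_of_ne huv
    have h1 : G.dist u v ≠ 1 := fun h1 => h.map_ne (SimpleGraph.dist_eq_one_iff_adj.1 h1) hπ
    have h2 := h.dist_ne_two hπ
    have h3 := h.dist_le_three hm u v
    omega

theorem IsCover.ediam_eq_three [Nontrivial W] (h : IsCover G ⊤ π) (hm : HasMidpoints G π)
    (hr : ∃ u v, u ≠ v ∧ π u = π v) : G.ediam = 3 := by
  refine le_antisymm (SimpleGraph.ediam_le_iff.2 fun u v => ?_) ?_
  · rw [← ((h.connected hm).preconnected u v).coe_dist_eq_edist]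
    exact_mod_cast h.dist_le_three hm u v
  · obtain ⟨u, v, huv, hπ⟩ := hr
    refine le_trans ?_ (SimpleGraph.edist_le_ediam (u := u) (v := v))
    rw [← ((h.connected hm).preconnected u v).coe_dist_eq_edist,
      (h.dist_eq_three_iff hm huv).2 hπ]
    rfl

theorem IsCover.isAntipodal [Nontrivial W] (h : IsCover G ⊤ π) (hm : HasMidpoints G π)
    (hr : ∃ u v, u ≠ v ∧ π u = π v) : IsAntipodal G π where
  connected := h.connected hm
  dist_eq_diam_iff u v huv := by
    rw [SimpleGraph.diam, h.ediam_eq_three hm hr]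
    exact h.dist_eq_three_iff hm huv

end Cover

/-! ### Translations, common neighbours and blocks of a gain graph -/

section GainGraph

variable {n : ℕ} {Γ : Type*} [CommGroup Γ] {V : Type*} {G : SimpleGraph V}
  {e : V ≃ Fin n × Γ} {b : Fin n → Fin n → Γ}

theorem IsGainGraph.isCover (h : IsGainGraph G e b) : IsCover G ⊤ (fun v => (e v).1) where
  surj i := ⟨e.symm (i, 1), by simp⟩
  adj u v huv := by simpa using ((h.adj u v).1 huv).1
  matching u i hi := by
    have hi : (e u).1 ≠ i := by simpa using hi
    refine ⟨e.symm (i, b i (e u).1 * (e u).2), ⟨by simp, ?_⟩, ?_⟩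
    · rw [h.adj]
      simp [hi, ← mul_assoc, h.inv _ _ hi]
    · rintro v ⟨rfl, hv⟩
      have hv2 := ((h.adj u v).1 hv).2
      rw [← e.symm_apply_apply v]
      congr 1
      ext1
      · simp
      · simp [hv2, ← mul_assoc, h.inv _ _ hi.symm]

/-- Right translation of all labels by one group element commutes with left multiplication by the
gains, so it preserves adjacency. -/
theorem IsGainGraph.exists_iso (h : IsGainGraph G e b) {u v : V} (huv : (e u).1 = (e v).1) :
    ∃ φ : G ≃g G, (∀ x, (e (φ x)).1 = (e x).1) ∧ φ u = v := by
  let f : V ≃ V := e.trans (((Equiv.refl (Fin n)).prodCongr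
    (Equiv.mulRight ((e u).2⁻¹ * (e v).2))).trans e.symm)
  have hf : ∀ x, e (f x) = ((e x).1, (e x).2 * ((e u).2⁻¹ * (e v).2)) := fun x => by
    simp only [f, Equiv.trans_apply, Equiv.apply_symm_apply]
    rfl
  refine ⟨⟨f, fun {x y} => ?_⟩, fun x => by simp [hf], ?_⟩
  · rw [h.adj, h.adj, hf, hf]
    simp only [← mul_assoc, mul_left_inj]
  · apply e.injective
    change e (f u) = e v
    rw [hf, mul_inv_cancel_left]
    exact Prod.ext huv rfl

theorem IsGainGraph.isRegularCover (h : IsGainGraph G e b) (hc : G.Connected) :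
    IsRegularCover G (fun v => (e v).1) := by
  refine ⟨h.isCover, fun u v huv => ?_⟩
  obtain ⟨φ, hφ, rfl⟩ := h.exists_iso huv
  exact ⟨φ, ⟨hφ, rfl⟩, fun ψ hψ => h.isCover.iso_eq hc hψ.1 hφ hψ.2⟩

/-- A common neighbour is determined by its fibre `k`: adjacency to `u` forces its label, and
adjacency to `v` then says that the path through `k` has gain equal to the label quotient. -/
theorem IsGainGraph.ncard_commonNeighbors (h : IsGainGraph G e b) (u v : V) :
    (G.commonNeighbors u v).ncard = pathCount b (e u).1 (e v).1 ((e u).2 * (e v).2⁻¹) := by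
  refine Set.ncard_congr (fun w _ => (e w).1) ?_ ?_ ?_
  · rintro w ⟨hu, hv⟩
    obtain ⟨hu1, hu2⟩ := (h.adj u w).1 hu
    obtain ⟨hv1, hv2⟩ := (h.adj v w).1 hv
    refine ⟨hu1.symm, hv1.symm, ?_⟩
    rw [hu2, hv2, mul_inv_rev, mul_assoc, mul_inv_cancel_left,
      eq_inv_of_mul_eq_one_left (h.inv _ _ hv1.symm)]
  · rintro w w' ⟨hu, -⟩ ⟨hu', -⟩ hww
    exact h.isCover.eq_of_adj hu hu' hww
  · rintro k ⟨hki, hkj, hk⟩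
    refine ⟨e.symm (k, b k (e u).1 * (e u).2), ⟨?_, ?_⟩, by simp⟩
    · rw [SimpleGraph.mem_neighborSet, h.adj]
      simp [hki.symm, ← mul_assoc, h.inv _ _ hki.symm]
    · rw [SimpleGraph.mem_neighborSet, h.adj]
      have hk' : (e u).2 = b (e u).1 k * b k (e v).1 * (e v).2 := by rw [hk]; simp
      refine ⟨by simpa using hkj.symm, ?_⟩
      simp only [Equiv.apply_symm_apply]
      rw [hk', ← mul_assoc, ← mul_assoc, ← mul_assoc, mul_assoc (b (e v).1 k),
        h.inv _ _ hki, mul_one, h.inv _ _ hkj.symm, one_mul]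

theorem IsGainGraph.isAbelianCover [Fintype Γ] (h : IsGainGraph G e b) :
    IsAbelianCover G (fun v => (e v).1) := by
  classical
  let f : Γ ≃ Fin (Fintype.card Γ) := Fintype.equivFin Γ
  let F : Γ →* Equiv.Perm (Fin (Fintype.card Γ)) :=
    (f.permCongrHom).toMonoidHom.comp (MulAction.toPermHom Γ Γ)
  have hF : ∀ g x, F g x = f (g * f.symm x) := fun g x => rfl
  refine ⟨h.isCover, Fintype.card Γ, e.trans ((Equiv.refl _).prodCongr f),
    fun i j => F (b i j), ⟨fun v => rfl, fun i x y hxy => ?_, fun i j hij x y => ?_⟩, ?_⟩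
  · simpa using ((h.adj _ _).1 hxy).1
  · rw [h.adj, hF]
    simp [hij, ← Equiv.eq_symm_apply, eq_comm]
  -- Every block lies in the image of the regular representation of `Γ`, which is commutative.
  · have hle : blockGroup (fun i j => F (b i j)) ≤ F.range :=
      (Subgroup.closure_le _).2 (by rintro _ ⟨i, j, -, rfl⟩; exact ⟨_, rfl⟩)
    intro s hs t ht
    obtain ⟨x, rfl⟩ := hle hs
    obtain ⟨y, rfl⟩ := hle ht
    rw [← map_mul, mul_comm, map_mul]

end GainGraph

/-! ### Covers among the Cayley matrices -/

open Classical in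
theorem satisfiesR123_of_cayleyIsAbelianCover {n : ℕ} {Γ : Type*} [CommGroup Γ]
    {B : Matrix (Fin n) (Fin n) (MonoidAlgebra ℂ Γ)} (h : CayleyIsAbelianCover B) :
    SatisfiesR123 B := by
  obtain ⟨G, hG, hc, -⟩ := h
  have hco : ∀ i j g, (B i j).coeff g = if G.Adj (i, g) (j, 1) then 1 else 0 := by
    intro i j g
    have := congrFun (congrFun hG (i, g)) (j, 1)
    simpa [SimpleGraph.adjMatrix_apply, cayley] using this.symm
  -- Entries of `cayley B` depend only on label quotients, so every adjacency can be translated to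
  -- one with second label `1`.
  have hinv : ∀ i j x g, G.Adj (i, x) (j, g) ↔ G.Adj (i, x * g⁻¹) (j, 1) := by
    intro i j x g
    have := congrFun (congrFun hG (i, x)) (j, g)
    simp only [SimpleGraph.adjMatrix_apply, cayley, Matrix.of_apply, hco] at this
    split_ifs at this <;> simp_all
  have hr2 : ∀ i j, i ≠ j → ∃ g : Γ, B i j = MonoidAlgebra.of ℂ Γ g ∧ G.Adj (i, g) (j, 1) := by
    intro i j hij
    obtain ⟨⟨_, g⟩, rfl, hg⟩ := hc.exists_adj (u := (j, (1 : Γ))) (w := i) hij.symm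
    refine ⟨g, ?_, hg.symm⟩
    ext x
    rw [hco, MonoidAlgebra.of_apply, MonoidAlgebra.coeff_single, Finsupp.single_apply]
    refine if_congr ⟨fun hx => ?_, fun hx => hx ▸ hg.symm⟩ rfl rfl
    exact congrArg Prod.snd (hc.eq_of_adj hg hx.symm rfl)
  refine ⟨fun i => ?_, fun i j hij => (hr2 i j hij).imp fun _ h => h.1, fun i j hij => ?_⟩
  · ext g
    have : ¬ G.Adj (i, g) (i, 1) := fun hg => hc.map_ne hg rfl
    simp [hco, this]
  · obtain ⟨g, hg, hga⟩ := hr2 i j hij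
    obtain ⟨g', hg', hga'⟩ := hr2 j i hij.symm
    rw [hg, hg', ← map_mul, ← map_one (MonoidAlgebra.of ℂ Γ)]
    have := (hinv _ _ _ _).1 hga.symm
    rw [one_mul] at this
    have := congrArg Prod.snd (hc.eq_of_adj hga'.symm this.symm rfl)
    simp only at this
    rw [this, mul_inv_cancel]

theorem satisfiesR123_iff_cayleyIsAbelianCover {n : ℕ} {Γ : Type*} [CommGroup Γ] [Fintype Γ]
    (B : Matrix (Fin n) (Fin n) (MonoidAlgebra ℂ Γ)) :
    SatisfiesR123 B ↔ CayleyIsAbelianCover B := by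
  classical
  refine ⟨fun h => ?_, satisfiesR123_of_cayleyIsAbelianCover⟩
  obtain ⟨b, hb, rfl⟩ := h.exists_eq_gainMatrix
  let G : SimpleGraph (Fin n × Γ) :=
    { Adj u v := u.1 ≠ v.1 ∧ u.2 = b u.1 v.1 * v.2
      symm := ⟨fun u v ⟨h1, h2⟩ => ⟨h1.symm, by rw [h2, ← mul_assoc, hb _ _ h1.symm, one_mul]⟩⟩
      loopless := ⟨fun u h => h.1 rfl⟩ }
  have hG : IsGainGraph G (Equiv.refl _) b := ⟨hb, fun u v => Iff.rfl⟩
  refine ⟨G, ?_, hG.isAbelianCover⟩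
  have := (adjMatrix_eq_cayley_iff G (Equiv.refl _) b).2 hG.adj
  simpa using this

/-! ### Diameter three and positivity of the parameters -/

section RouxGraph

variable {n : ℕ} {Γ : Type*} [CommGroup Γ] {V : Type*} {G : SimpleGraph V}
  {e : V ≃ Fin n × Γ} {b : Fin n → Fin n → Γ} {c : Γ → ℂ}

theorem IsGainGraph.ncard_commonNeighbors_eq (h : IsGainGraph G e b)
    (hc : ∀ i j, i ≠ j → ∀ g, (pathCount b i j (g * b i j) : ℂ) = c g) {u v : V}
    (huv : (e u).1 ≠ (e v).1) :
    ((G.commonNeighbors u v).ncard : ℂ) =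
      c ((e u).2 * (e v).2⁻¹ * (b (e u).1 (e v).1)⁻¹) := by
  rw [h.ncard_commonNeighbors, ← hc _ _ huv, inv_mul_cancel_right]

theorem IsGainGraph.adj_iff_eq_one (h : IsGainGraph G e b) {u v : V}
    (huv : (e u).1 ≠ (e v).1) :
    G.Adj u v ↔ (e u).2 * (e v).2⁻¹ * (b (e u).1 (e v).1)⁻¹ = 1 := by
  rw [h.adj, mul_inv_eq_one, mul_inv_eq_iff_eq_mul]
  exact and_iff_right huv

theorem IsGainGraph.hasMidpoints [Finite V] (h : IsGainGraph G e b)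
    (hc : ∀ i j, i ≠ j → ∀ g, (pathCount b i j (g * b i j) : ℂ) = c g)
    (hpos : ∀ g, g ≠ 1 → 0 < c g) : HasMidpoints G (fun v => (e v).1) := by
  intro u v huv hadj
  have h0 := hpos _ fun h1 => hadj ((h.adj_iff_eq_one huv).2 h1)
  rw [← h.ncard_commonNeighbors_eq hc huv, Nat.cast_pos, Set.ncard_pos] at h0
  obtain ⟨w, hw1, hw2⟩ := h0
  exact ⟨w, hw1, hw2.symm⟩

theorem IsGainGraph.exists_mates [Nontrivial Γ] [NeZero n] (e : V ≃ Fin n × Γ) :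
    ∃ u v, u ≠ v ∧ (e u).1 = (e v).1 := by
  obtain ⟨g, hg⟩ := exists_ne (1 : Γ)
  exact ⟨e.symm (0, g), e.symm (0, 1), by simpa using hg, by simp⟩

/-- Mates with labels `g` and `1` are joined by a walk of length at most 3, and the cover excludes
lengths 0, 1 and 2. In a walk `u, x, y, v` the vertex `y` is one of the `c g` common neighbours of
`x` and `v`. -/
theorem IsGainGraph.pos_of_ediam_eq_three [Finite V] [NeZero n] (h : IsGainGraph G e b)
    (hc : ∀ i j, i ≠ j → ∀ g, (pathCount b i j (g * b i j) : ℂ) = c g)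
    (hd : G.ediam = 3) {g : Γ} (hg : g ≠ 1) : 0 < c g := by
  obtain ⟨u, hu⟩ : ∃ u, e u = (0, g) := ⟨_, e.apply_symm_apply _⟩
  obtain ⟨v, hv⟩ : ∃ v, e v = (0, 1) := ⟨_, e.apply_symm_apply _⟩
  have huv : u ≠ v := by
    rintro rfl
    exact hg (congrArg Prod.snd (hu.symm.trans hv))
  have hπ : (e u).1 = (e v).1 := by rw [hu, hv]
  have hle : G.edist u v ≤ 3 := hd ▸ SimpleGraph.edist_le_ediam
  obtain ⟨p, hp⟩ := SimpleGraph.exists_walk_of_edist_ne_top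
    (ne_top_of_le_ne_top (by simp) hle)
  rw [← hp] at hle
  have hle : p.length ≤ 3 := by exact_mod_cast hle
  clear hp
  cases p with
  | nil => exact absurd rfl huv
  | @cons _ x _ hux p =>
  cases p with
  | nil => exact absurd hπ (h.isCover.map_ne hux)
  | @cons _ y _ hxy p =>
  cases p with
  | nil => exact absurd (h.isCover.eq_of_adj hux.symm hxy hπ) huv
  | @cons _ z _ hyz p =>
  cases p with
  | cons _ p =>
    simp only [SimpleGraph.Walk.length_cons] at hle
    omega
  | nil =>
    have hxv : (e x).1 ≠ (e v).1 := hπ ▸ (h.isCover.map_ne hux).symm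
    have hval := ((h.adj x u).1 hux.symm).2
    have hcg := h.ncard_commonNeighbors_eq hc hxv
    -- The gain from `x` to `u` and its inverse cancel by commutativity, leaving the argument `g`.
    rw [hval, hu, hv, inv_one, mul_one, mul_inv_cancel_comm] at hcg
    rw [← hcg, Nat.cast_pos, Set.ncard_pos]
    exact ⟨y, hxy, hyz.symm⟩

theorem IsRouxGraph.ediam_eq_three_iff [Finite V] [Fintype Γ] [Nontrivial Γ] {π : V → Fin n}
    (hn : 2 ≤ n) (hG : IsRouxGraph G π c) :
    (G.ediam = 3 ↔ ∀ g : Γ, g ≠ 1 → 0 < c g) ∧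
      (G.ediam = 3 → IsAntipodal G π ∧ IsRegularCover G π) := by
  obtain ⟨e, b, he, h, hc⟩ := (isRouxGraph_iff G π c).1 hG
  obtain rfl : (fun v => (e v).1) = π := funext he
  have : NeZero n := ⟨by omega⟩
  have : Nontrivial (Fin n) := Fin.nontrivial_iff_two_le.2 hn
  have hiff : G.ediam = 3 ↔ ∀ g : Γ, g ≠ 1 → 0 < c g :=
    ⟨fun hd g hg => h.pos_of_ediam_eq_three hc hd hg, fun hpos =>
      h.isCover.ediam_eq_three (h.hasMidpoints hc hpos) (IsGainGraph.exists_mates e)⟩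
  refine ⟨hiff, fun hd => ?_⟩
  have hm := h.hasMidpoints hc (hiff.1 hd)
  exact ⟨h.isCover.isAntipodal hm (IsGainGraph.exists_mates e),
    h.isRegularCover (h.isCover.connected hm)⟩

end RouxGraph

/-! ### Distance-regularity from the matrix algebra -/

section DistanceRegular

variable {V W : Type*} {G : SimpleGraph V} {π : V → W}

/-- The entry of `M` at `(u, v)` depends only on the distance between `u` and `v`. -/
def DistDetermined (G : SimpleGraph V) (M : Matrix V V ℂ) : Prop :=
  ∀ u v u' v', G.dist u v = G.dist u' v' → M u v = M u' v'

open Classical in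
/-- The `0`-`1` matrix of a relation. -/
noncomputable def relMatrix (R : V → V → Prop) : Matrix V V ℂ :=
  Matrix.of fun u v => if R u v then 1 else 0

theorem relMatrix_mul_apply [Fintype V] (R S : V → V → Prop) (u v : V) :
    (relMatrix R * relMatrix S) u v = ({w | R u w ∧ S w v}.ncard : ℂ) := by
  classical
  simp only [Matrix.mul_apply, relMatrix, Matrix.of_apply, ← ite_and, mul_ite, mul_one, mul_zero]
  rw [Finset.sum_boole, Set.ncard_eq_toFinset_card']
  congr 2
  ext w
  simp [and_comm]

theorem relMatrix_transpose {R : V → V → Prop} (hR : ∀ u v, R u v ↔ R v u) :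
    (relMatrix R).transpose = relMatrix R := by
  classical
  ext u v
  simp only [relMatrix, Matrix.transpose_apply, Matrix.of_apply]
  exact if_congr (hR v u) rfl rfl

theorem DistDetermined.transpose {M : Matrix V V ℂ} (h : DistDetermined G M) :
    DistDetermined G M.transpose := fun u v u' v' huv =>
  h v u v' u' (by rw [G.dist_comm, huv, G.dist_comm])

theorem distDetermined_relMatrix {R : V → V → Prop} (p : ℕ → Prop)
    (h : ∀ u v, R u v ↔ p (G.dist u v)) : DistDetermined G (relMatrix R) := by
  classical
  intro u v u' v' huv
  simp only [relMatrix, Matrix.of_apply]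
  exact if_congr (by rw [h, h, huv]) rfl rfl

/-- The matrices whose entries depend only on the distance form a subspace. -/
def distSubmodule (G : SimpleGraph V) : Submodule ℂ (Matrix V V ℂ) where
  carrier := {M | DistDetermined G M}
  add_mem' hM hN u v u' v' h := congrArg₂ (· + ·) (hM u v u' v' h) (hN u v u' v' h)
  zero_mem' _ _ _ _ _ := rfl
  smul_mem' a _ hM u v u' v' h := congrArg (a • ·) (hM u v u' v' h)

theorem IsCover.ncard_neighborSet [Fintype V] [Fintype W] (h : IsCover G ⊤ π) (u : V) :
    {w | G.Adj u w}.ncard = Fintype.card W - 1 := by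
  have : {w | G.Adj u w}.ncard = ({π u}ᶜ : Set W).ncard := by
    refine Set.ncard_congr (fun w _ => π w) (fun w hw => (h.map_ne hw).symm)
      (fun w w' hw hw' hww => h.eq_of_adj hw hw' hww) fun i hi => ?_
    obtain ⟨v, rfl, hv⟩ := h.exists_adj (Ne.symm hi : π u ≠ i)
    exact ⟨v, hv, rfl⟩
  rw [this, Set.ncard_compl, Set.ncard_singleton, Nat.card_eq_fintype_card]

open Classical in
theorem IsCover.ncard_adj_fibre (h : IsCover G ⊤ π) (u v : V) :
    {w | G.Adj u w ∧ π w = π v}.ncard = if π u = π v then 0 else 1 := by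
  split_ifs with huv
  · convert Set.ncard_empty V
    ext w
    simp only [Set.mem_ofPred_eq, Set.mem_empty_iff_false, iff_false]
    exact fun hw => h.map_ne hw.1 (huv.trans hw.2.symm)
  · obtain ⟨x, hx, hux⟩ := h.exists_adj huv
    rw [Set.ncard_eq_one]
    refine ⟨x, Set.eq_singleton_iff_unique_mem.2 ⟨⟨hux, hx⟩, fun w hw => ?_⟩⟩
    exact h.eq_of_adj hw.1 hux (hw.2.trans hx.symm)

theorem IsCover.map_eq_iff_dist [Nontrivial W] (h : IsCover G ⊤ π) (hm : HasMidpoints G π)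
    (u v : V) : π u = π v ↔ G.dist u v = 0 ∨ G.dist u v = 3 := by
  by_cases huv : u = v
  · simp [huv]
  · rw [h.dist_eq_three_iff hm huv, (h.connected hm).dist_eq_zero_iff]
    simp [huv]

/-- The distance matrices are `I`, `A`, `J - F - A` and `F - I`, where `F` records a common fibre
and `J` is all ones. Products of the four generators depend only on distance, so by bilinearity
products of distance matrices do too; the entries of the latter are the required counts. -/
theorem IsCover.isDistanceRegular [Fintype V] [Fintype W] [Nontrivial W] (h : IsCover G ⊤ π)
    (hm : HasMidpoints G π) {r : ℕ} (hr : ∀ i, {v | π v = i}.ncard = r) {a c : ℂ}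
    (ha : ∀ u v, G.Adj u v → ((G.commonNeighbors u v).ncard : ℂ) = a)
    (hc : ∀ u v, π u ≠ π v → ¬ G.Adj u v → ((G.commonNeighbors u v).ncard : ℂ) = c) :
    IsDistanceRegular G := by
  classical
  have hconn := h.connected hm
  refine ⟨hconn, fun i j u v u' v' huv => ?_⟩
  set I : Matrix V V ℂ := relMatrix (fun u v => u = v) with hI
  set A : Matrix V V ℂ := relMatrix (fun u v => G.Adj u v) with hA
  set F : Matrix V V ℂ := relMatrix (fun u v => π u = π v) with hF
  set J : Matrix V V ℂ := relMatrix (fun _ _ => True) with hJ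
  have hI1 : I = 1 := by ext u v; simp [hI, relMatrix, Matrix.one_apply]
  have hAt : A.transpose = A := relMatrix_transpose fun u v => G.adj_comm u v
  have hFt : F.transpose = F := relMatrix_transpose fun u v => eq_comm
  have hJt : J.transpose = J := relMatrix_transpose fun u v => Iff.rfl
  have dI : DistDetermined G I :=
    distDetermined_relMatrix (fun d => d = 0) fun u v => hconn.dist_eq_zero_iff.symm
  have dA : DistDetermined G A :=
    distDetermined_relMatrix (fun d => d = 1) fun u v => SimpleGraph.dist_eq_one_iff_adj.symm
  have dF : DistDetermined G F :=
    distDetermined_relMatrix (fun d => d = 0 ∨ d = 3) (h.map_eq_iff_dist hm)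
  have dJ : DistDetermined G J := distDetermined_relMatrix (fun _ => True) fun _ _ => Iff.rfl
  -- The only product involving `a` and `c`; mates contribute zero since they have no common
  -- neighbour.
  have dAA : DistDetermined G (A * A) := by
    have key : ∀ u v, (A * A) u v = if G.dist u v = 0 then ((Fintype.card W - 1 : ℕ) : ℂ)
        else if G.dist u v = 1 then a else if G.dist u v = 2 then c else 0 := by
      intro u v
      rw [hA, relMatrix_mul_apply]
      have hcn : {w | G.Adj u w ∧ G.Adj w v} = G.commonNeighbors u v := by
        ext w
        simp [SimpleGraph.mem_commonNeighbors, G.adj_comm w v]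
      by_cases h0 : u = v
      · subst h0
        rw [SimpleGraph.dist_self, if_pos rfl, ← h.ncard_neighborSet u]
        congr 2
        ext w
        simp [G.adj_comm w u]
      rw [if_neg (fun h1 => h0 (hconn.dist_eq_zero_iff.1 h1)), hcn]
      by_cases hadj : G.Adj u v
      · rw [if_pos (SimpleGraph.dist_eq_one_iff_adj.2 hadj), ha u v hadj]
      rw [if_neg fun h1 => hadj (SimpleGraph.dist_eq_one_iff_adj.1 h1)]
      by_cases hπ : π u = π v
      · rw [if_neg (h.dist_ne_two hπ), ← hcn]
        have : {w | G.Adj u w ∧ G.Adj w v} = ∅ := by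
          ext w
          simp only [Set.mem_ofPred_eq, Set.mem_empty_iff_false, iff_false]
          exact fun hw => h0 (h.eq_of_adj hw.1.symm hw.2 hπ)
        rw [this, Set.ncard_empty, Nat.cast_zero]
      · have h3 := mt (h.dist_eq_three_iff hm h0).1 hπ
        have h1 := mt SimpleGraph.dist_eq_one_iff_adj.1 hadj
        have h0' := mt hconn.dist_eq_zero_iff.1 h0
        have hle := h.dist_le_three hm u v
        rw [if_pos (by omega), hc u v hπ hadj]
    intro u v u' v' huv
    rw [key, key, huv]
  have dAF : DistDetermined G (A * F) := by
    intro u v u' v' huv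
    rw [relMatrix_mul_apply, relMatrix_mul_apply, h.ncard_adj_fibre, h.ncard_adj_fibre]
    simp only [h.map_eq_iff_dist hm, huv]
  -- The generators are symmetric, so reversing a product is a transposition, which preserves
  -- dependence on distance.
  have dFA : DistDetermined G (F * A) := by
    rw [← hFt, ← hAt, ← Matrix.transpose_mul]; exact dAF.transpose
  have dAJ : DistDetermined G (A * J) := by
    intro u v u' v' _
    simp only [hA, hJ, relMatrix_mul_apply, and_true, h.ncard_neighborSet]
  have dJA : DistDetermined G (J * A) := by
    rw [← hJt, ← hAt, ← Matrix.transpose_mul]; exact dAJ.transpose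
  have dFF : DistDetermined G (F * F) := by
    have key : ∀ u v, {w | π u = π w ∧ π w = π v}.ncard = if π u = π v then r else 0 := by
      intro u v
      split_ifs with h1
      · rw [← hr (π v)]
        congr 1
        ext w
        simp only [Set.mem_ofPred_eq, h1]
        exact ⟨fun h => h.2, fun h => ⟨h.symm, h⟩⟩
      · convert Set.ncard_empty V
        ext w
        simp only [Set.mem_ofPred_eq, Set.mem_empty_iff_false, iff_false]
        exact fun hw => h1 (hw.1.trans hw.2)
    intro u v u' v' huv
    rw [hF, relMatrix_mul_apply, relMatrix_mul_apply, key, key]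
    simp only [h.map_eq_iff_dist hm, huv]
  have dFJ : DistDetermined G (F * J) := by
    intro u v u' v' _
    have hr' : ∀ u, {w | π u = π w}.ncard = r := fun u => by simpa only [eq_comm] using hr (π u)
    simp only [hF, hJ, relMatrix_mul_apply, and_true, hr']
  have dJF : DistDetermined G (J * F) := by
    rw [← hJt, ← hFt, ← Matrix.transpose_mul]; exact dFJ.transpose
  have dJJ : DistDetermined G (J * J) := by
    intro u v u' v' _
    simp only [hJ, relMatrix_mul_apply]
  have hmul : Submodule.span ℂ {I, A, F, J} * Submodule.span ℂ {I, A, F, J} ≤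
      distSubmodule G := by
    rw [Submodule.span_mul_span, Submodule.span_le]
    rintro _ ⟨X, hX, Y, hY, rfl⟩
    simp only [Set.mem_insert_iff, Set.mem_singleton_iff] at hX hY
    change DistDetermined G (X * Y)
    rcases hX with rfl | rfl | rfl | rfl <;> rcases hY with rfl | rfl | rfl | rfl <;>
      first
      | assumption
      | (rw [hI1, one_mul]; assumption)
      | (rw [hI1, mul_one]; assumption)
  have hD : ∀ i : ℕ, relMatrix (fun u v => G.dist u v = i) ∈
      Submodule.span ℂ ({I, A, F, J} : Set (Matrix V V ℂ)) := by
    intro i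
    have mI : I ∈ Submodule.span ℂ ({I, A, F, J} : Set (Matrix V V ℂ)) :=
      Submodule.subset_span (by simp)
    have mA : A ∈ Submodule.span ℂ ({I, A, F, J} : Set (Matrix V V ℂ)) :=
      Submodule.subset_span (by simp)
    have mF : F ∈ Submodule.span ℂ ({I, A, F, J} : Set (Matrix V V ℂ)) :=
      Submodule.subset_span (by simp)
    have mJ : J ∈ Submodule.span ℂ ({I, A, F, J} : Set (Matrix V V ℂ)) :=
      Submodule.subset_span (by simp)
    have hIe : ∀ u v, I u v = if G.dist u v = 0 then 1 else 0 := fun u v => by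
      simp only [hI, relMatrix, Matrix.of_apply, hconn.dist_eq_zero_iff]
    have hAe : ∀ u v, A u v = if G.dist u v = 1 then 1 else 0 := fun u v => by
      simp only [hA, relMatrix, Matrix.of_apply, SimpleGraph.dist_eq_one_iff_adj]
    have hFe : ∀ u v, F u v = if G.dist u v = 0 ∨ G.dist u v = 3 then 1 else 0 := fun u v => by
      simp only [hF, relMatrix, Matrix.of_apply, h.map_eq_iff_dist hm]
    have hJe : ∀ u v, J u v = 1 := fun u v => by simp [hJ, relMatrix]
    have main : ∀ M : Matrix V V ℂ, M ∈ Submodule.span ℂ ({I, A, F, J} : Set (Matrix V V ℂ)) →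
        (∀ u v, G.dist u v ≤ 3 → M u v = if G.dist u v = i then 1 else 0) →
        relMatrix (fun u v => G.dist u v = i) ∈
          Submodule.span ℂ ({I, A, F, J} : Set (Matrix V V ℂ)) := by
      intro M hM hMe
      convert hM using 1
      ext u v
      rw [hMe u v (h.dist_le_three hm u v)]
      simp [relMatrix]
    match i with
    | 0 => exact main I mI fun u v _ => hIe u v
    | 1 => exact main A mA fun u v _ => hAe u v
    | 2 =>
      refine main (J - F - A) (sub_mem (sub_mem mJ mF) mA) fun u v hle => ?_
      rw [Matrix.sub_apply, Matrix.sub_apply, hJe, hFe, hAe]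
      interval_cases G.dist u v <;> simp
    | 3 =>
      refine main (F - I) (sub_mem mF mI) fun u v hle => ?_
      rw [Matrix.sub_apply, hFe, hIe]
      interval_cases G.dist u v <;> simp
    | i + 4 =>
      refine main 0 (zero_mem _) fun u v hle => ?_
      rw [if_neg (by omega)]
      rfl
  have := hmul (Submodule.mul_mem_mul (hD i) (hD j)) u v u' v' huv
  rw [relMatrix_mul_apply, relMatrix_mul_apply] at this
  simpa only [G.dist_comm (u := v), G.dist_comm (u := v'), Nat.cast_inj] using this

end DistanceRegular

theorem IsRouxGraph.isAbelianDrackn {n : ℕ} {Γ : Type*} [CommGroup Γ] [Fintype Γ] [Nontrivial Γ]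
    {V : Type*} [Fintype V] {G : SimpleGraph V} {π : V → Fin n} {c : ℕ} (hn : 2 ≤ n) (hc : 0 < c)
    (hG : IsRouxGraph G π (drackParams Γ n (Fintype.card Γ) c)) :
    IsAbelianDrackn G π (Fintype.card Γ) c := by
  obtain ⟨e, b, he, h, hp⟩ := (isRouxGraph_iff G π _).1 hG
  obtain rfl : (fun v => (e v).1) = π := funext he
  have : NeZero n := ⟨by omega⟩
  have : Nontrivial (Fin n) := Fin.nontrivial_iff_two_le.2 hn
  have hm := h.hasMidpoints hp fun g hg => by simpa [drackParams, hg] using hc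
  have hcn : ∀ u v, (e u).1 ≠ (e v).1 → ¬ G.Adj u v →
      ((G.commonNeighbors u v).ncard : ℂ) = c := fun u v huv hadj => by
    rw [h.ncard_commonNeighbors_eq hp huv, drackParams, if_neg]
    exact fun h1 => hadj ((h.adj_iff_eq_one huv).2 h1)
  have hr : ∀ i, {v | (e v).1 = i}.ncard = Fintype.card Γ := fun i => by
    rw [← Nat.card_eq_fintype_card, ← Set.ncard_univ]
    refine Set.ncard_congr (fun v _ => (e v).2) (fun _ _ => Set.mem_univ _)
      (fun u v hu hv huv => e.injective (Prod.ext (Eq.trans hu (Eq.symm hv)) huv))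
      fun g _ => ⟨e.symm (i, g), by simp, by simp⟩
  refine ⟨⟨h.isCover, h.isCover.isAntipodal hm (IsGainGraph.exists_mates e),
    h.isCover.isDistanceRegular hm hr
      (a := (n : ℂ) - (c : ℂ) * ((Fintype.card Γ : ℂ) - 1) - 2) (fun u v huv => ?_) hcn, hr, fun u v huv => ?_⟩,
    h.isAbelianCover⟩
  · rw [h.ncard_commonNeighbors_eq hp (h.isCover.map_ne huv),
      (h.adj_iff_eq_one (h.isCover.map_ne huv)).1 huv, drackParams, if_pos rfl]
  · have := hcn u v (fun hπ => h.isCover.dist_ne_two hπ huv) fun hadj => by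
      rw [SimpleGraph.dist_eq_one_iff_adj.2 hadj] at huv
      omega
    exact_mod_cast this

/-! ### Distances in antipodal covers -/

theorem _root_.SimpleGraph.Connected.exists_adj_dist_add_one {V : Type*} {G : SimpleGraph V}
    (hc : G.Connected) {u v : V} (huv : u ≠ v) :
    ∃ y, G.Adj v y ∧ G.dist u y + 1 = G.dist u v := by
  obtain ⟨p, hp⟩ := hc.exists_walk_length_eq_dist v u
  cases p with
  | nil => exact absurd rfl huv
  | @cons _ y _ h q =>
    refine ⟨y, h, ?_⟩
    rw [SimpleGraph.Walk.length_cons] at hp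
    have h1 := SimpleGraph.dist_le q
    have h2 := hc.dist_triangle (u := v) (v := y) (w := u)
    rw [SimpleGraph.dist_eq_one_iff_adj.2 h] at h2
    rw [G.dist_comm (u := u), G.dist_comm (u := u)]
    omega

section Antipodal

variable {V W : Type*} [Finite V] {G : SimpleGraph V} {π : V → W}

theorem IsAntipodal.dist_le_diam (ha : IsAntipodal G π) (u v : V) : G.dist u v ≤ G.diam :=
  have := ha.connected.nonempty
  SimpleGraph.dist_le_diam (SimpleGraph.connected_iff_ediam_ne_top.1 ha.connected)

/-- Two fibres make the diameter positive, so a pair realising it is distinct, and antipodality puts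
it in one fibre. -/
theorem IsAntipodal.exists_mates [Nontrivial W] (h : IsCover G ⊤ π) (ha : IsAntipodal G π) :
    ∃ u v, u ≠ v ∧ π u = π v := by
  have := ha.connected.nonempty
  obtain ⟨i, j, hij⟩ := exists_pair_ne W
  obtain ⟨u, rfl⟩ := h.surj i
  obtain ⟨v, rfl⟩ := h.surj j
  have huv : u ≠ v := fun h => hij (congrArg π h)
  obtain ⟨x, y, hxy⟩ := G.exists_dist_eq_diam
  refine ⟨x, y, ?_, ?_⟩
  · rintro rfl
    rw [SimpleGraph.dist_self] at hxy
    have h1 := ha.dist_le_diam u v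
    have h2 := ha.connected.pos_dist_of_ne huv
    omega
  · refine (ha.dist_eq_diam_iff x y ?_).1 hxy
    rintro rfl
    rw [SimpleGraph.dist_self] at hxy
    have h1 := ha.dist_le_diam u v
    have h2 := ha.connected.pos_dist_of_ne huv
    omega

/-- The neighbour of `u` in the fibre of `v` is a mate of `v`, at distance `G.diam`; so `u` is at
most one closer, and it cannot itself be at that distance. -/
theorem IsAntipodal.dist_add_one_eq_diam (h : IsCover G ⊤ π) (ha : IsAntipodal G π) {u v : V}
    (hπ : π u ≠ π v) (hadj : ¬ G.Adj u v) : G.dist u v + 1 = G.diam := by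
  obtain ⟨w, hw, huw⟩ := h.exists_adj hπ
  have hwv : w ≠ v := by
    rintro rfl
    exact hadj huw
  have h1 := (ha.dist_eq_diam_iff w v hwv).2 hw
  have h2 := ha.connected.dist_triangle (u := w) (v := u) (w := v)
  rw [SimpleGraph.dist_eq_one_iff_adj.2 huw.symm] at h2
  have h3 := mt (ha.dist_eq_diam_iff u v fun h => hπ (congrArg π h)).1 hπ
  have h4 := ha.dist_le_diam u v
  omega

/-- Let `y` precede `v` on a geodesic from `u`. Were `y` a mate of `u` it would be too far away;
were it a non-neighbour in another fibre it would be exactly as far as `v`. So `y` is adjacent to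
`u`. -/
theorem IsAntipodal.dist_eq_two (h : IsCover G ⊤ π) (ha : IsAntipodal G π) {u v : V}
    (hπ : π u ≠ π v) (hadj : ¬ G.Adj u v) : G.dist u v = 2 := by
  have huv : u ≠ v := fun h => hπ (congrArg π h)
  obtain ⟨y, hvy, hy⟩ := ha.connected.exists_adj_dist_add_one huv
  have hd := ha.dist_add_one_eq_diam h hπ hadj
  have huy : u ≠ y := by
    rintro rfl
    exact hadj hvy.symm
  by_cases hπy : π u = π y
  · have := (ha.dist_eq_diam_iff u y huy).2 hπy
    omega
  by_cases hadjy : G.Adj u y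
  · rw [← hy, SimpleGraph.dist_eq_one_iff_adj.2 hadjy]
  · have := ha.dist_add_one_eq_diam h hπy hadjy
    omega

theorem IsAntipodal.exists_dist_eq_two [Nontrivial W] (h : IsCover G ⊤ π) (ha : IsAntipodal G π) :
    ∃ u v, G.dist u v = 2 := by
  obtain ⟨u, v, huv, hπ⟩ := ha.exists_mates h
  obtain ⟨i, hi⟩ := exists_ne (π u)
  obtain ⟨w, rfl, hw⟩ := h.exists_adj hi.symm
  exact ⟨w, v, ha.dist_eq_two h (hπ ▸ hi) fun hwv => huv (h.eq_of_adj hw.symm hwv hπ)⟩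

end Antipodal

theorem _root_.SimpleGraph.commonNeighbors_nonempty_of_dist_eq_two {V : Type*}
    {G : SimpleGraph V} {u v : V} (h : G.dist u v = 2) : (G.commonNeighbors u v).Nonempty := by
  obtain ⟨p, hp⟩ := SimpleGraph.exists_walk_of_dist_ne_zero (G := G) (u := u) (v := v) (by omega)
  rw [h] at hp
  match p, hp with
  | .cons h1 (.cons h2 .nil), _ => exact ⟨_, h1, h2.symm⟩

/-! ### Labels from an abelian block group -/

section BlockForm

variable {n r : ℕ} {V : Type*} {G : SimpleGraph V} {π : V → Fin n} {e : V ≃ Fin n × Fin r}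
  {σ : Fin n → Fin n → Equiv.Perm (Fin r)}

theorem IsBlockForm.adj_iff (h : IsBlockForm G π e σ) (u v : V) :
    G.Adj u v ↔ (e u).1 ≠ (e v).1 ∧ (e u).2 = σ (e u).1 (e v).1 (e v).2 := by
  by_cases huv : (e u).1 = (e v).1
  · have := h.diag (e u).1 (e u).2 (e v).2
    rw [show ((e u).1, (e v).2) = e v from Prod.ext huv rfl, Prod.mk.eta,
      e.symm_apply_apply, e.symm_apply_apply] at this
    simp [huv, this]
  · have := h.offDiag _ _ huv (e u).2 (e v).2
    simpa [huv, eq_comm] using this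

theorem IsBlockForm.mul_eq_one (h : IsBlockForm G π e σ) {i j : Fin n} (hij : i ≠ j) :
    σ i j * σ j i = 1 := by
  ext x
  have h1 := (h.offDiag j i hij.symm (σ j i x) x).2 rfl
  have h2 := (h.offDiag i j hij x (σ j i x)).1 h1.symm
  simp [h2]

theorem IsBlockForm.exists_apply_eq (h : IsBlockForm G π e σ) {u v : V} (p : G.Walk u v) :
    ∃ s ∈ blockGroup σ, (e u).2 = s (e v).2 := by
  induction p with
  | nil => exact ⟨1, one_mem _, rfl⟩
  | @cons u w v hadj _ ih =>
    obtain ⟨s, hs, hsw⟩ := ih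
    obtain ⟨h1, h2⟩ := (h.adj_iff u w).1 hadj
    exact ⟨σ _ _ * s, mul_mem (Subgroup.subset_closure ⟨_, _, h1, rfl⟩) hs, by
      rw [h2, hsw, Equiv.Perm.mul_apply]⟩

/-- The labels of a connected abelian cover may be taken in the group generated by the blocks. -/
theorem IsBlockForm.exists_isGainGraph [NeZero n] (h : IsBlockForm G π e σ) (hc : G.Connected)
    {Γ : Type*} [CommGroup Γ] (f : Γ ≃* blockGroup σ) :
    Nonempty (Γ ≃ Fin r) ∧ ∃ (e' : V ≃ Fin n × Γ) (b : Fin n → Fin n → Γ),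
      (∀ v, (e' v).1 = π v) ∧ IsGainGraph G e' b := by
  classical
  obtain ⟨v₀⟩ := hc.nonempty
  let x₀ := (e v₀).2
  let φ : Γ →* Equiv.Perm (Fin r) := (blockGroup σ).subtype.comp f.toMonoidHom
  have hφ : Function.Injective φ := Subtype.val_injective.comp f.injective
  have hsurj : ∀ s ∈ blockGroup σ, ∃ g, φ g = s := fun s hs => ⟨f.symm ⟨s, hs⟩, by simp [φ]⟩
  -- Transitivity: along a walk between two vertices of one fibre the label changes by a product of
  -- blocks.
  have htrans : ∀ x y, ∃ g, φ g x = y := fun x y => by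
    obtain ⟨p⟩ := hc.preconnected (e.symm (0, y)) (e.symm (0, x))
    obtain ⟨s, hs, hsy⟩ := h.exists_apply_eq p
    obtain ⟨g, rfl⟩ := hsurj s hs
    exact ⟨g, by simpa using hsy.symm⟩
  -- In a transitive abelian group, agreement at `x₀` transports to every point by commuting past
  -- the element that moves `x₀` there.
  have hfree : Function.Injective fun g => φ g x₀ := by
    intro g g' hgg
    apply hφ
    ext y
    obtain ⟨k, rfl⟩ := htrans x₀ y
    have hgg : φ g x₀ = φ g' x₀ := hgg
    rw [← Equiv.Perm.mul_apply, ← Equiv.Perm.mul_apply, ← map_mul, ← map_mul, mul_comm g,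
      mul_comm g', map_mul, map_mul, Equiv.Perm.mul_apply, Equiv.Perm.mul_apply, hgg]
  let E : Γ ≃ Fin r := Equiv.ofBijective (fun g => φ g x₀) ⟨hfree, fun y => htrans x₀ y⟩
  have hE : ∀ x, φ (E.symm x) x₀ = x := E.apply_symm_apply
  have hb : ∀ i j, ∃ g, i ≠ j → φ g = σ i j := fun i j => by
    by_cases hij : i = j
    · exact ⟨1, fun h => absurd hij h⟩
    · obtain ⟨g, hg⟩ := hsurj (σ i j) (Subgroup.subset_closure ⟨i, j, hij, rfl⟩)
      exact ⟨g, fun _ => hg⟩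
  choose b hb using hb
  refine ⟨⟨E⟩, e.trans ((Equiv.refl _).prodCongr E.symm), b, fun v => h.fibre v,
    fun i j hij => hφ ?_, fun u v => ?_⟩
  · rw [map_mul, hb i j hij, hb j i hij.symm, h.mul_eq_one hij, map_one]
  · rw [h.adj_iff]
    refine and_congr_right fun huv => ?_
    change _ ↔ E.symm (e u).2 = b (e u).1 (e v).1 * E.symm (e v).2
    rw [← hfree.eq_iff]
    simp only [map_mul, Equiv.Perm.mul_apply, hE, hb _ _ huv]

end BlockForm

/-! ### Parameters of an abelian drackn -/

/-- Each `k` outside `{i, j}` gives a path with exactly one gain. The natural subtraction is not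
truncated, since `i ≠ j` forces `n ≥ 2`. -/
theorem sum_pathCount {n : ℕ} {Γ : Type*} [CommGroup Γ] [Fintype Γ] (b : Fin n → Fin n → Γ)
    {i j : Fin n} (hij : i ≠ j) : ∑ g, pathCount b i j (g * b i j) = n - 2 := by
  classical
  rw [show ∑ g, pathCount b i j (g * b i j) = ∑ h, pathCount b i j h from
    Fintype.sum_equiv (Equiv.mulRight (b i j)) _ _ fun _ => rfl]
  have h1 : ∀ h, pathCount b i j h =
      (({i, j}ᶜ : Finset (Fin n)).filter fun k => b i k * b k j = h).card := fun h => by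
    rw [pathCount, ← Set.ncard_coe_finset]
    congr 1
    ext k
    simp [and_assoc]
  simp only [h1]
  rw [← Finset.card_eq_sum_card_fiberwise (f := fun k => b i k * b k j)
    (fun _ _ => Finset.mem_coe.2 (Finset.mem_univ _)), Finset.card_compl,
    Finset.card_pair hij, Fintype.card_fin]

theorem IsDrackn.isRouxGraph {n r c : ℕ} {V : Type*} [Finite V] {G : SimpleGraph V}
    {π : V → Fin n} (hn : 2 ≤ n) (h : IsDrackn G π r c) {Γ : Type*} [CommGroup Γ] [Fintype Γ]
    {e : V ≃ Fin n × Γ} {b : Fin n → Fin n → Γ} (he : ∀ v, (e v).1 = π v)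
    (hG : IsGainGraph G e b) (hr : Fintype.card Γ = r) :
    IsRouxGraph G π (drackParams Γ n r c) := by
  classical
  -- Labels `g * b i j` and `1` give non-adjacent vertices in distinct fibres, hence at distance 2.
  have hne : ∀ i j, i ≠ j → ∀ g : Γ, g ≠ 1 → pathCount b i j (g * b i j) = c := by
    intro i j hij g hg
    obtain ⟨u, hu⟩ : ∃ u, e u = (i, g * b i j) := ⟨_, e.apply_symm_apply _⟩
    obtain ⟨v, hv⟩ : ∃ v, e v = (j, 1) := ⟨_, e.apply_symm_apply _⟩
    have hπ : π u ≠ π v := by rw [← he, ← he, hu, hv]; exact hij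
    have hadj : ¬ G.Adj u v := fun hadj => by
      have := ((hG.adj u v).1 hadj).2
      rw [hu, hv] at this
      exact hg (by simpa using this)
    have := hG.ncard_commonNeighbors u v
    rw [h.card_common u v (h.antipodal.dist_eq_two h.cover hπ hadj), hu, hv] at this
    simpa using this.symm
  refine (isRouxGraph_iff G π _).2 ⟨e, b, he, hG, fun i j hij g => ?_⟩
  by_cases hg : g = 1
  -- The identity parameter is what remains of the total `n - 2` after `r - 1` terms equal to `c`.
  · have hsum := sum_pathCount b hij
    rw [← Finset.add_sum_erase _ _ (Finset.mem_univ (1 : Γ)),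
      Finset.sum_congr rfl fun k hk => hne i j hij k (Finset.ne_of_mem_erase hk),
      Finset.sum_const, Finset.card_erase_of_mem (Finset.mem_univ _), Finset.card_univ, hr,
      smul_eq_mul] at hsum
    have hr1 : 1 ≤ r := hr ▸ Fintype.card_pos
    have hsum' : (pathCount b i j (1 * b i j) : ℂ) + ((r : ℂ) - 1) * c = n - 2 := by
      exact_mod_cast congrArg (Nat.cast : ℕ → ℂ) hsum
    subst hg
    rw [drackParams, if_pos rfl]
    linear_combination hsum'
  · rw [hne i j hij g hg, drackParams, if_neg hg]

theorem IsDrackn.pos {n r c : ℕ} {V : Type*} [Finite V] {G : SimpleGraph V} {π : V → Fin n}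
    (hn : 2 ≤ n) (h : IsDrackn G π r c) : 0 < c := by
  have : Nontrivial (Fin n) := Fin.nontrivial_iff_two_le.2 hn
  obtain ⟨u, v, huv⟩ := h.antipodal.exists_dist_eq_two h.cover
  rw [← h.card_common u v huv, Set.ncard_pos]
  exact SimpleGraph.commonNeighbors_nonempty_of_dist_eq_two huv

theorem IsBlockForm.ncard_fibre {n r : ℕ} {V : Type*} {G : SimpleGraph V} {π : V → Fin n}
    {e : V ≃ Fin n × Fin r} {σ : Fin n → Fin n → Equiv.Perm (Fin r)} (h : IsBlockForm G π e σ)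
    (i : Fin n) : {v | π v = i}.ncard = r := by
  conv_rhs => rw [← Fintype.card_fin r, ← Nat.card_eq_fintype_card, ← Set.ncard_univ]
  refine Set.ncard_congr (fun v _ => (e v).2) (fun _ _ => Set.mem_univ _)
    (fun u v hu hv huv => e.injective (Prod.ext ?_ huv))
    fun g _ => ⟨e.symm (i, g), by simp [← h.fibre], by simp⟩
  rw [h.fibre, h.fibre]
  exact Eq.trans hu (Eq.symm hv)

theorem IsDrackn.isRouxGraph_of_isBlockForm {n r c : ℕ} {V : Type*} [Finite V]
    {G : SimpleGraph V} {π : V → Fin n} (hn : 2 ≤ n) (h : IsDrackn G π r c)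
    {e : V ≃ Fin n × Fin r} {σ : Fin n → Fin n → Equiv.Perm (Fin r)} (hb : IsBlockForm G π e σ)
    {Γ : Type*} [CommGroup Γ] [Fintype Γ] (f : Γ ≃* blockGroup σ) :
    Fintype.card Γ = r ∧ IsRouxGraph G π (drackParams Γ n r c) := by
  have : NeZero n := ⟨by omega⟩
  obtain ⟨⟨E⟩, e', b, he, hG⟩ := hb.exists_isGainGraph h.antipodal.connected f
  have hr : Fintype.card Γ = r := by rw [Fintype.card_congr E, Fintype.card_fin]
  exact ⟨hr, h.isRouxGraph hn he hG hr⟩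

theorem IsAbelianDrackn.exists_isRouxGraph {n r c : ℕ} {V : Type*} [Finite V]
    {G : SimpleGraph V} {π : V → Fin n} (hn : 2 ≤ n) (h : IsAbelianDrackn G π r c) :
    ∃ (Γ : Type) (_ : CommGroup Γ) (_ : Fintype Γ),
      Fintype.card Γ = r ∧ IsRouxGraph G π (drackParams Γ n r c) := by
  obtain ⟨hd, -, r', e, σ, hb, hcomm⟩ := h
  -- The abelian labelling carries its own fibre size; counting one fibre identifies it with `r`.
  obtain rfl : r' = r := by
    rw [← hd.card_fibre ⟨0, by omega⟩, hb.ncard_fibre]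
  let _ : CommGroup (blockGroup σ) :=
    { mul_comm := fun s t => Subtype.ext (hcomm s s.2 t t.2) }
  let _ : Fintype (blockGroup σ) := Fintype.ofFinite _
  exact ⟨blockGroup σ, inferInstance, inferInstance,
    hd.isRouxGraph_of_isBlockForm hn hb (MulEquiv.refl _)⟩

end Roux

theorem theorem5p2 :
    -- (a)
    (∀ {V : Type*} [Fintype V] (n r c : ℕ) (G : SimpleGraph V) (π : V → Fin n),
      2 ≤ n → IsAbelianDrackn G π r c →
        0 < c ∧
        (∃ (Γ : Type) (_ : CommGroup Γ) (_ : Fintype Γ),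
          Fintype.card Γ = r ∧ IsRouxGraph G π (drackParams Γ n r c)) ∧
        -- moreover, `Γ` may be any abelian group generated by the blocks
        (∀ (e : V ≃ Fin n × Fin r) (σ : Fin n → Fin n → Equiv.Perm (Fin r)),
          IsBlockForm G π e σ →
          ∀ {Γ : Type*} [CommGroup Γ] [Fintype Γ], (Γ ≃* blockGroup σ) →
            Fintype.card Γ = r ∧ IsRouxGraph G π (drackParams Γ n r c))) ∧
    -- (b)
    (∀ {Γ : Type*} [CommGroup Γ] [Fintype Γ] (n : ℕ)
      (B : Matrix (Fin n) (Fin n) (MonoidAlgebra ℂ Γ)),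
      SatisfiesR123 B ↔ CayleyIsAbelianCover B) ∧
    -- (c)
    (∀ {V : Type*} [Fintype V] {Γ : Type*} [CommGroup Γ] [Fintype Γ] [Nontrivial Γ] (n : ℕ)
      (G : SimpleGraph V) (π : V → Fin n) (c : Γ → ℂ),
      2 ≤ n → IsRouxGraph G π c →
        (G.ediam = 3 ↔ ∀ g : Γ, g ≠ 1 → 0 < c g) ∧
        (G.ediam = 3 → IsAntipodal G π ∧ IsRegularCover G π)) ∧
    -- (d)
    (∀ {V : Type*} [Fintype V] {Γ : Type*} [CommGroup Γ] [Fintype Γ] [Nontrivial Γ] (n c : ℕ)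
      (G : SimpleGraph V) (π : V → Fin n),
      2 ≤ n → 0 < c → IsRouxGraph G π (drackParams Γ n (Fintype.card Γ) c) →
        IsAbelianDrackn G π (Fintype.card Γ) c) := by
  refine ⟨fun n r c G π hn h => ⟨h.1.pos hn, h.exists_isRouxGraph hn, fun e σ hb Γ _ _ f =>
    h.1.isRouxGraph_of_isBlockForm hn hb f⟩, fun n B => satisfiesR123_iff_cayleyIsAbelianCover B,
    fun n G π c hn hG => hG.ediam_eq_three_iff hn, fun n c G π hn hc hG =>
      hG.isAbelianDrackn hn hc⟩
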